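/- **Setting.** Let $n\ge 2$, let $\varepsilon_1,\dots,\varepsilon_n$ be the standard basis of $V=\mathbb R^n$, and let $\mathring\Phi=\mathring\Phi_s\cup\mathring\Phi_\ell\cup\mathring\Phi_d$ be the root system of type $BC_n$, with $\mathring\Phi_s=\{\pm\varepsilon_i\}$, $\mathring\Phi_\ell=\{\pm\varepsilon_i\pm\varepsilon_j: i\ne j\}$, $\mathring\Phi_d=\{\pm2\varepsilon_i\}$. Let $Y$ be a finite-dimensional real vector space and $(\Lambda_\alpha)_{\alpha\in\mathring\Phi\cup\{0\}}$ an extension datum: subsets $\Lambda_\alpha\subseteq Y$ whose union spans $Y$, with $\Lambda_\beta-(\beta,\alpha^\vee)\Lambda_\alpha\subseteq\Lambda_{s_\alpha(\beta)}$ for $\alpha,\beta\in\mathring\Phi$, with $0\in\Lambda_\alpha$ for $\alpha\in\mathring\Phi_s\cup\mathring\Phi_\ell\cup\{0\}$, and with $\Lambda_\alpha\ne\emptyset$ for $\alpha\in\mathring\Phi_d$. Then $\Lambda_\alpha$ depends only on the type of $\alpha$; write $\Lambda_s,\Lambda_\ell,\Lambda_d$. If $n=2$, assume that $\Lambda_\ell$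 is a subgroup of $Y$ (this is automatic for $n\ge3$). Let $\Phi=\{\alpha\oplus y:\alpha\in\mathring\Phi,\ y\in\Lambda_\alpha\}\subseteq V\oplus Y$ be the set of real roots of the associated affine reflection system, with form $(v\oplus y,v'\oplus y')=(v,v')$, and let $\Phi_B$ be the set of those roots with $\alpha\in\mathring\Phi_s\cup\mathring\Phi_\ell$. A root subsystem of $\Phi$ is a non-empty subset $\Psi$ with $s_a(b)\in\Psi$ for all $a,b\in\Psi$; it is maximal if it is proper and not properly contained in another proper root subsystem. Put $Y_\alpha(\Psi)=\{y:\alpha\oplus y\in\Psi\}$ and $\mathrm{Gr}(\Psi)=\{\alpha\in\mathring\Phi:Y_\alpha(\Psi)\neq\emptyset\}$. A function on a set of roots is called $\mathbb Z$-linear if it is the restriction of an additive map on the lattice generated by that set. For $T\subseteq Y$, $\langle T\rangle$ is the subgroup generated by $T$. A union of cosets in $M/G$ means a subset of $M$ that is stable under translation by the subgroup $G$. A maximal subgroup is a maximal proper subgroup. **Proposition.** Let $\Psi$ be a maximal root subsystem of $\Phi$ with $\mathrm{Gr}(\Psi)=\mathring\Phi$ and $\Psi_B:=\Psi\cap\Phi_B\neq\Phi_B$.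 Let $p:\mathring\Phi_s\cup\mathring\Phi_\ell\to Y$ be $\mathbb Z$-linear with $p_\alpha\in Y_\alpha(\Psi_B)$ for all $\alpha$. 1. Suppose $\Lambda_s\ne\Lambda_\ell$ and $\Psi_B=\{\alpha\oplus(p_\alpha+S):\alpha\in\mathring\Phi_s\}\cup\{\alpha\oplus\Lambda_\ell:\alpha\in\mathring\Phi_\ell\}$, where $S$ is maximal among the unions $T$ of cosets in $\langle\Lambda_s\rangle/\Lambda_\ell$ such that $p_\alpha+T\subseteq\Lambda_s$ for all $\alpha\in\mathring\Phi_s$ and not all of these inclusions are equalities. Then $$\Psi=\Psi_B\cup\{\alpha\oplus\Lambda_d:\alpha\in\mathring\Phi_d\}.$$ 2. Suppose $\Lambda_\ell\ne\langle2\Lambda_s\rangle$ and $\Psi_B=\{\alpha\oplus\Lambda_s:\alpha\in\mathring\Phi_s\}\cup\{\alpha\oplus(p_\alpha+H):\alpha\in\mathring\Phi_\ell\}$, where $H$ is a maximal subgroup of $\Lambda_\ell$ with $2\Lambda_s\subseteq H$. Then there is a $\mathbb Z$-linear function $q:\mathring\Phi_\ell\cup\mathring\Phi_d\to\Lambda_\ell$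 with $q_\alpha\in Y_\alpha(\Psi)$ for all $\alpha$, such that $$\Psi=\Psi_B\cup\{\alpha\oplus\big((q_\alpha+H)\cap\Lambda_d\big):\alpha\in\mathring\Phi_d\}.$$ 3. Suppose $\Psi_B=\{\alpha\oplus(p_\alpha+S):\alpha\in\mathring\Phi_s\}\cup\{\alpha\oplus(p_\alpha+H):\alpha\in\mathring\Phi_\ell\}$, where $H$ is a maximal subgroup of $\Lambda_\ell$ with $H+\langle2\Lambda_s\rangle=\Lambda_\ell$, and $S$ is maximal among the unions $T$ of cosets in $\langle\Lambda_s\rangle/H$ with $H\subseteq T$, $2T\subseteq H$, and $p_\alpha+T\subseteq\Lambda_s$ for all $\alpha\in\mathring\Phi_s$. * (a) If $\Lambda_d\subseteq H$, then $\Psi=\Psi_B\cup\{\alpha\oplus\Lambda_d:\alpha\in\mathring\Phi_d\}$. * (b) If $\Lambda_d\not\subseteq H$, then there are a $\mathbb Z$-linear function $p':\mathring\Phi_\ell\cup\mathring\Phi_d\to\Lambda_\ell$, with $p'_\alpha\in Y_\alpha(\Psi)$ for all $\alpha$ and $p'_\beta=p_\beta$ for $\beta=\varepsilon_i-\varepsilon_{i+1}$,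 $1\le i<n$, and a set $Y_d'\subseteq H$ such that $$\Psi=\Psi_B\cup\{\alpha\oplus(p'_\alpha+Y_d'):\alpha\in\mathring\Phi_d\},$$ where, with $a_n=2p_{\varepsilon_n}-p'_{2\varepsilon_n}$, the set $Y_d'$ is maximal among the unions $Z$ of cosets in $H/2H$ such that $p'_\alpha+Z\subseteq\Lambda_d$ for all $\alpha\in\mathring\Phi_d$, $a_n+S\subseteq S$ and $2a_n+Z\subseteq Z$. (If $S=\bigcup_{a\in A}(a+H)$ and $Z=\bigcup_{b\in B}(b+2H)$ for sets of cosets $A$ and $B$, the last two conditions say $a_n+A\subseteq A$ and $2a_n+B\subseteq B$.) -/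

import Mathlib

open scoped Pointwise

namespace BCReflection

/-- The Euclidean space `V = ℝⁿ` containing the finite root system of type `BC_n`. -/
abbrev E (n : ℕ) := EuclideanSpace ℝ (Fin n)

/-- The standard orthonormal basis vector `ε_i`. -/
noncomputable def eps {n : ℕ} (i : Fin n) : E n := EuclideanSpace.single i 1

/-- The short roots `±ε_i`. -/
def shortRoots (n : ℕ) : Set (E n) := {α | ∃ i, α = eps i ∨ α = -eps i}

/-- The long roots `±ε_i ± ε_j`, `i ≠ j`. -/
def longRoots (n : ℕ) : Set (E n) :=
  {α | ∃ i j, i ≠ j ∧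
    (α = eps i + eps j ∨ α = eps i - eps j ∨ α = -eps i + eps j ∨ α = -eps i - eps j)}

/-- The divisible roots `±2ε_i`. -/
def divRoots (n : ℕ) : Set (E n) :=
  {α | ∃ i, α = (2 : ℝ) • eps i ∨ α = -((2 : ℝ) • eps i)}

/-- The finite root system of type `BC_n`. -/
def roots (n : ℕ) : Set (E n) := shortRoots n ∪ longRoots n ∪ divRoots n

/-- The number `(β, α^∨) = 2 (β, α) / (α, α)`. -/
noncomputable def cartan {n : ℕ} (β α : E n) : ℝ := 2 * inner ℝ β α / inner ℝ α α

/-- An extension datum of type `(BC_n, Y)`; only the values of `Λ` on `roots n ∪ {0}` matter. -/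
structure ExtensionDatum (n : ℕ) (Y : Type*) [AddCommGroup Y] [Module ℝ Y] where
  Λ : E n → Set Y
  /-- `Λ_β - (β, α^∨) Λ_α ⊆ Λ_{s_α β}`. -/
  sub_mem : ∀ α ∈ roots n, ∀ β ∈ roots n, ∀ x ∈ Λ β, ∀ y ∈ Λ α,
    x - cartan β α • y ∈ Λ (β - cartan β α • α)
  zero_mem : ∀ α ∈ shortRoots n ∪ longRoots n ∪ {0}, (0 : Y) ∈ Λ α
  nonempty : ∀ α ∈ divRoots n, (Λ α).Nonempty
  span_eq : Submodule.span ℝ (⋃ α ∈ roots n ∪ {0}, Λ α) = ⊤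

/-- The set `⋃_{α ∈ R} α ⊕ Z_α` in `X = V ⊕ Y`. -/
def piece {n : ℕ} {Y : Type*} (R : Set (E n)) (Z : E n → Set Y) : Set (E n × Y) :=
  {x | x.1 ∈ R ∧ x.2 ∈ Z x.1}

section

variable {n : ℕ} {Y : Type*} [AddCommGroup Y] [Module ℝ Y]

/-- The bilinear form on `X = V ⊕ Y`, with radical `Y`. -/
noncomputable def form (x y : E n × Y) : ℝ := inner ℝ x.1 y.1

/-- The reflection `s_a(x) = x - 2 (x, a) / (a, a) a` of `X = V ⊕ Y`. -/
noncomputable def reflection (a x : E n × Y) : E n × Y :=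
  x - (2 * form x a / form a a) • a

/-- `Ψ` is a root subsystem of `Φ`. -/
def IsRootSubsystem (Φ Ψ : Set (E n × Y)) : Prop :=
  Ψ.Nonempty ∧ Ψ ⊆ Φ ∧ ∀ a ∈ Ψ, ∀ b ∈ Ψ, reflection a b ∈ Ψ

/-- `Ψ` is a maximal root subsystem of `Φ`, that is, maximal among the proper ones. -/
def IsMaximalRootSubsystem (Φ Ψ : Set (E n × Y)) : Prop :=
  IsRootSubsystem Φ Ψ ∧ Ψ ≠ Φ ∧
    ∀ Ψ' : Set (E n × Y), IsRootSubsystem Φ Ψ' → Ψ' ≠ Φ → Ψ ⊆ Ψ' → Ψ = Ψ'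

/-- The fibre `Y_α(Ψ) = {y | α ⊕ y ∈ Ψ}`. -/
def fiber (Ψ : Set (E n × Y)) (α : E n) : Set Y := {y | (α, y) ∈ Ψ}

/-- `p` restricts to a `ℤ`-linear function on the set `R`, that is, to the restriction to `R`
of an additive map defined on the lattice generated by `R`. -/
def IsIntLinearOn (R : Set (E n)) (p : E n → Y) : Prop :=
  ∃ f : AddSubgroup.closure R →+ Y,
    ∀ (α : E n) (h : α ∈ R), p α = f ⟨α, AddSubgroup.subset_closure h⟩

/-- The subset `T` of `Y` is a subgroup, and `H` is a maximal (proper) subgroup of it. -/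
def IsMaximalSubgroup (H : AddSubgroup Y) (T : Set Y) : Prop :=
  (∃ G : AddSubgroup Y, (G : Set Y) = T) ∧ (H : Set Y) ⊆ T ∧ (H : Set Y) ≠ T ∧
    ∀ K : AddSubgroup Y, H ≤ K → (K : Set Y) ⊆ T → K = H ∨ (K : Set Y) = T

/-- `T` is a subset of `M` which is a union of cosets of `G`. -/
def IsUnionOfCosets (G M T : Set Y) : Prop :=
  T ⊆ M ∧ ∀ t ∈ T, ∀ g ∈ G, t + g ∈ T

/-- The subgroup `⟨2 T⟩` generated by the doubles of the elements of `T`. -/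
def doubleSpan (T : Set Y) : AddSubgroup Y :=
  AddSubgroup.closure ((fun x : Y => (2 : ℤ) • x) '' T)

namespace ExtensionDatum

variable (D : ExtensionDatum n Y)

/-- `Λ_s`; all `Λ_α` with `α` short coincide, and this is their common value. -/
def Λs : Set Y := ⋃ α ∈ shortRoots n, D.Λ α

/-- `Λ_ℓ`; all `Λ_α` with `α` long coincide, and this is their common value. -/
def Λl : Set Y := ⋃ α ∈ longRoots n, D.Λ α

/-- `Λ_d`; all `Λ_α` with `α` divisible coincide, and this is their common value. -/
def Λd : Set Y := ⋃ α ∈ divRoots n, D.Λ α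

/-- The real roots `Φ = ⋃_{α} α ⊕ Λ_α` of the affine reflection system of the datum. -/
def Φ : Set (E n × Y) := piece (roots n) D.Λ

/-- The subsystem `Φ_B` of the roots over `±ε_i` and `±ε_i ± ε_j`. -/
def ΦB : Set (E n × Y) := piece (shortRoots n ∪ longRoots n) D.Λ

/-- The gradient of a subset of `Φ`. -/
def Gr (Ψ : Set (E n × Y)) : Set (E n) := {α | α ∈ roots n ∧ ∃ y ∈ D.Λ α, (α, y) ∈ Ψ}

/-- `p` is `ℤ`-linear on the roots of type `B_n` and selects an element in each fibre of `Θ`. -/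
def IsSectionB (p : E n → Y) (Θ : Set (E n × Y)) : Prop :=
  IsIntLinearOn (shortRoots n ∪ longRoots n) p ∧
    ∀ α ∈ shortRoots n ∪ longRoots n, p α ∈ fiber Θ α

/-- First form of a maximal root subsystem `Θ` of `Φ_B`: full on the long roots, while the short
roots carry the translates `p_α + S` of a maximal union `S` of cosets in `⟨Λ_s⟩ / Λ_ℓ`. As always
for such unions, `p_α + S` must be contained in `Λ_s`, and maximality is among the choices
that do not give all of `Φ_B`. -/
def FormOne (p : E n → Y) (S : Set Y) (Θ : Set (E n × Y)) : Prop :=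
  D.Λs ≠ D.Λl ∧ IsSectionB p Θ ∧
  Maximal (fun T : Set Y =>
    IsUnionOfCosets D.Λl (AddSubgroup.closure D.Λs : Set Y) T ∧
    (∀ α ∈ shortRoots n, p α +ᵥ T ⊆ D.Λs) ∧
    ¬ ∀ α ∈ shortRoots n, p α +ᵥ T = D.Λs) S ∧
  Θ = piece (shortRoots n) (fun α => p α +ᵥ S) ∪ piece (longRoots n) (fun _ => D.Λl)

/-- Second form: full on the short roots, and the translates `p_α + H` on the long roots, where
`H` is a maximal subgroup of `Λ_ℓ` containing `2Λ_s`. -/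
def FormTwo (p : E n → Y) (H : AddSubgroup Y) (Θ : Set (E n × Y)) : Prop :=
  D.Λl ≠ (doubleSpan D.Λs : Set Y) ∧ IsSectionB p Θ ∧
  IsMaximalSubgroup H D.Λl ∧ (∀ x ∈ D.Λs, (2 : ℤ) • x ∈ H) ∧
  Θ = piece (shortRoots n) (fun _ => D.Λs) ∪
    piece (longRoots n) (fun α => p α +ᵥ (H : Set Y))

/-- Third form: the translates `p_α + S` on the short roots and `p_α + H` on the long roots,
where `H` is a maximal subgroup of `Λ_ℓ` with `H + ⟨2Λ_s⟩ = Λ_ℓ`, and `S` is maximal among the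
unions of cosets in `⟨Λ_s⟩ / H` which contain `H`, satisfy `2S ⊆ H`, and whose translates
`p_α + S` are contained in `Λ_s`. -/
def FormThree (p : E n → Y) (S : Set Y) (H : AddSubgroup Y) (Θ : Set (E n × Y)) : Prop :=
  IsSectionB p Θ ∧
  IsMaximalSubgroup H D.Λl ∧ ((H ⊔ doubleSpan D.Λs : AddSubgroup Y) : Set Y) = D.Λl ∧
  Maximal (fun T : Set Y =>
    IsUnionOfCosets (H : Set Y) (AddSubgroup.closure D.Λs : Set Y) T ∧
    (H : Set Y) ⊆ T ∧ (∀ t ∈ T, (2 : ℤ) • t ∈ H) ∧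
    ∀ α ∈ shortRoots n, p α +ᵥ T ⊆ D.Λs) S ∧
  Θ = piece (shortRoots n) (fun α => p α +ᵥ S) ∪
    piece (longRoots n) (fun α => p α +ᵥ (H : Set Y))

/-- `q` is a `ℤ`-linear function from the long and divisible roots to `Λ_ℓ` which selects an
element in each fibre of `Ψ`. -/
def IsSectionC (q : E n → Y) (Ψ : Set (E n × Y)) : Prop :=
  IsIntLinearOn (longRoots n ∪ divRoots n) q ∧
    ∀ α ∈ longRoots n ∪ divRoots n, q α ∈ D.Λl ∧ q α ∈ fiber Ψ α

end ExtensionDatum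

end

end BCReflection

/-! Maximality of `Ψ` does the main work (`eq_inter_union_piece`). If sets Z_α ⊆ Λ_α over the
divisible roots contain the fibres of `Ψ` and are compatible with its B-part under reflections, then
adjoining them to that B-part gives a root subsystem containing `Ψ`. It is proper because its B-part
is already proper, so it equals `Ψ`. Each case thus asks for a large enough compatible Z.

Extend p to the real-linear map P with P(ε_i) = p(ε_i). A reflection in a divisible α ⊕ y moves the
B-fibres, measured from P, by integer multiples of y − P_α. In the first form P_α ∈ 2Λ_s ⊆ Λ_ℓ and
Λ_d ⊆ Λ_ℓ, and S absorbs both, so all of Λ_d fits. When the long fibres are cosets P_α + H, the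
divisible fibres lie in P_α + H (`sub_mem_of_div`). In the second form P_α ∈ 2Λ_s ⊆ H, and Z = H ∩
Λ_d works. In the third form Λ_d ⊆ H forces P_α ∈ H, and again all of Λ_d fits.

In general P need not select elements of the divisible fibres. With c in the fibre over 2ε_n and a =
2P(ε_n) − c ∈ H, lowering every P(ε_i) by a/2 repairs this and leaves P(ε_i − ε_j) unchanged
(`exists_shiftSection`). Relative to the new section all divisible fibres are one set Y_d ⊆ H,
stable under 2H. Conversely every such set that fits into Λ_d and contains Y_d is compatible with
the reflections, so maximality of `Ψ` becomes maximality of Y_d. The conditions on a hold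
automatically because a ∈ H. -/

namespace BCReflection

/-! ### Coordinates and Cartan numbers -/

section Finite

variable {n : ℕ}

/-- `s` is one of the signs `1`, `-1`. -/
def IsSign (s : ℝ) : Prop := s = 1 ∨ s = -1

lemma isSign_one : IsSign 1 := Or.inl rfl

lemma IsSign.neg {s : ℝ} (hs : IsSign s) : IsSign (-s) := by
  rcases hs with rfl | rfl <;> simp [IsSign]

lemma IsSign.mul {s t : ℝ} (hs : IsSign s) (ht : IsSign t) : IsSign (s * t) := by
  rcases hs with rfl | rfl <;> rcases ht with rfl | rfl <;> simp [IsSign]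

lemma IsSign.mul_self {s : ℝ} (hs : IsSign s) : s * s = 1 := by
  rcases hs with rfl | rfl <;> simp

lemma IsSign.exists_int {s : ℝ} (hs : IsSign s) : ∃ m : ℤ, s = m := by
  rcases hs with rfl | rfl
  · exact ⟨1, by simp⟩
  · exact ⟨-1, by simp⟩

lemma mem_shortRoots_iff {α : E n} :
    α ∈ shortRoots n ↔ ∃ i s, IsSign s ∧ α = s • eps i := by
  constructor
  · rintro ⟨i, rfl | rfl⟩
    · exact ⟨i, 1, by simp [IsSign]⟩
    · exact ⟨i, -1, by simp [IsSign]⟩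
  · rintro ⟨i, s, rfl | rfl, rfl⟩
    · exact ⟨i, by simp⟩
    · exact ⟨i, by simp⟩

lemma mem_divRoots_iff {α : E n} :
    α ∈ divRoots n ↔ ∃ i s, IsSign s ∧ α = (2 * s) • eps i := by
  constructor
  · rintro ⟨i, rfl | rfl⟩
    · exact ⟨i, 1, by simp [IsSign]⟩
    · exact ⟨i, -1, by simp [IsSign]⟩
  · rintro ⟨i, s, rfl | rfl, rfl⟩
    · exact ⟨i, by simp⟩
    · exact ⟨i, by simp⟩

lemma mem_longRoots_iff {α : E n} :
    α ∈ longRoots n ↔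
      ∃ i j s t, i ≠ j ∧ IsSign s ∧ IsSign t ∧ α = s • eps i + t • eps j := by
  constructor
  · rintro ⟨i, j, hij, rfl | rfl | rfl | rfl⟩
    · exact ⟨i, j, 1, 1, hij, by simp [IsSign]⟩
    · exact ⟨i, j, 1, -1, hij, by simp [IsSign, sub_eq_add_neg]⟩
    · exact ⟨i, j, -1, 1, hij, by simp [IsSign]⟩
    · exact ⟨i, j, -1, -1, hij, by simp [IsSign, sub_eq_add_neg]⟩
  · rintro ⟨i, j, s, t, hij, rfl | rfl, rfl | rfl, rfl⟩ <;>
      refine ⟨i, j, hij, ?_⟩ <;> simp [sub_eq_add_neg]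

lemma inner_eps (β : E n) (i : Fin n) : inner ℝ β (eps i) = β i := by
  simp [eps, EuclideanSpace.inner_single_right]

lemma eps_apply (i j : Fin n) : (eps i : E n) j = if j = i then 1 else 0 := by
  simp [eps]

lemma cartan_add (u v α : E n) : cartan (u + v) α = cartan u α + cartan v α := by
  simp [cartan, inner_add_left, mul_add, add_div]

lemma cartan_smul (c : ℝ) (v α : E n) : cartan (c • v) α = c * cartan v α := by
  simp only [cartan, real_inner_smul_left]; ring

lemma cartan_smul_eps (β : E n) (i : Fin n) {s : ℝ} (hs : s ≠ 0) :
    cartan β (s • eps i) = 2 * β i / s := by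
  simp only [cartan, real_inner_smul_left, real_inner_smul_right, inner_eps, eps_apply]
  field_simp
  simp

lemma cartan_long (β : E n) {i j : Fin n} (hij : i ≠ j) {s t : ℝ} (hs : IsSign s)
    (ht : IsSign t) : cartan β (s • eps i + t • eps j) = s * β i + t * β j := by
  have h : inner ℝ (s • eps i + t • eps j : E n) (s • eps i + t • eps j) = 2 := by
    simp only [inner_add_right, real_inner_smul_right, inner_eps, PiLp.add_apply,
      PiLp.smul_apply, smul_eq_mul, eps_apply, hij, hij.symm, if_true, if_false]
    linarith [hs.mul_self, ht.mul_self]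
  rw [cartan, h]
  simp only [inner_add_right, real_inner_smul_right, inner_eps]
  ring

lemma cartan_short (β : E n) (i : Fin n) {s : ℝ} (hs : IsSign s) :
    cartan β (s • eps i) = 2 * (s * β i) := by
  rcases hs with rfl | rfl
  · rw [cartan_smul_eps _ _ one_ne_zero]; ring
  · rw [cartan_smul_eps _ _ (by norm_num)]; ring

lemma cartan_div (β : E n) (i : Fin n) {s : ℝ} (hs : IsSign s) :
    cartan β ((2 * s) • eps i) = s * β i := by
  rcases hs with rfl | rfl
  · rw [cartan_smul_eps _ _ (by norm_num)]; ring
  · rw [cartan_smul_eps _ _ (by norm_num)]; ring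

lemma inner_self_of_short {α : E n} (h : α ∈ shortRoots n) : inner ℝ α α = (1 : ℝ) := by
  obtain ⟨i, s, hs, rfl⟩ := mem_shortRoots_iff.1 h
  simp only [real_inner_smul_right, inner_eps, PiLp.smul_apply, smul_eq_mul, eps_apply, if_true]
  linarith [hs.mul_self]

lemma inner_self_of_long {α : E n} (h : α ∈ longRoots n) : inner ℝ α α = (2 : ℝ) := by
  obtain ⟨i, j, s, t, hij, hs, ht, rfl⟩ := mem_longRoots_iff.1 h
  simp only [inner_add_right, real_inner_smul_right, inner_eps, PiLp.add_apply,
      PiLp.smul_apply, smul_eq_mul, eps_apply, hij, hij.symm, if_true, if_false]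
  linarith [hs.mul_self, ht.mul_self]

lemma inner_self_of_div {α : E n} (h : α ∈ divRoots n) : inner ℝ α α = (4 : ℝ) := by
  obtain ⟨i, s, hs, rfl⟩ := mem_divRoots_iff.1 h
  simp only [real_inner_smul_right, inner_eps, PiLp.smul_apply, smul_eq_mul, eps_apply, if_true]
  linarith [hs.mul_self]

/-- The squared lengths 1, 2, 4 separate the three types. -/
lemma not_long_of_short {α : E n} (h : α ∈ shortRoots n) : α ∉ longRoots n := fun h' => by
  linarith [inner_self_of_short h, inner_self_of_long h']

lemma not_div_of_B {α : E n} (h : α ∈ shortRoots n ∪ longRoots n) : α ∉ divRoots n := fun h' => by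
  rcases h with h | h
  · linarith [inner_self_of_short h, inner_self_of_div h']
  · linarith [inner_self_of_long h, inner_self_of_div h']

lemma mem_roots_of_short {α : E n} (h : α ∈ shortRoots n) : α ∈ roots n := Or.inl (Or.inl h)
lemma mem_roots_of_long {α : E n} (h : α ∈ longRoots n) : α ∈ roots n := Or.inl (Or.inr h)
lemma mem_roots_of_div {α : E n} (h : α ∈ divRoots n) : α ∈ roots n := Or.inr h

lemma exists_int_coord_of_B {β : E n} (h : β ∈ shortRoots n ∪ longRoots n) (k : Fin n) :
    ∃ m : ℤ, β k = m := by
  rcases h with h | h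
  · obtain ⟨i, s, hs, rfl⟩ := mem_shortRoots_iff.1 h
    obtain ⟨m, rfl⟩ := hs.exists_int
    exact ⟨m * if k = i then 1 else 0, by simp [eps_apply]⟩
  · obtain ⟨i, j, s, t, hij, hs, ht, rfl⟩ := mem_longRoots_iff.1 h
    obtain ⟨m, rfl⟩ := hs.exists_int
    obtain ⟨l, rfl⟩ := ht.exists_int
    exact ⟨(m * if k = i then 1 else 0) + l * if k = j then 1 else 0, by simp [eps_apply]⟩

lemma exists_int_coord_of_div {β : E n} (h : β ∈ divRoots n) (k : Fin n) :
    ∃ m : ℤ, β k = 2 * m := by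
  obtain ⟨i, s, hs, rfl⟩ := mem_divRoots_iff.1 h
  obtain ⟨m, rfl⟩ := hs.exists_int
  exact ⟨m * if k = i then 1 else 0, by simp [eps_apply]⟩

lemma cartan_B_div {β α : E n} (hβ : β ∈ shortRoots n ∪ longRoots n) (hα : α ∈ divRoots n) :
    ∃ m : ℤ, cartan β α = m := by
  obtain ⟨i, s, hs, rfl⟩ := mem_divRoots_iff.1 hα
  obtain ⟨m, hm⟩ := exists_int_coord_of_B hβ i
  obtain ⟨k, hk⟩ := hs.exists_int
  exact ⟨k * m, by rw [cartan_div _ _ hs, hm, hk]; push_cast; ring⟩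

lemma cartan_div_div {β α : E n} (hβ : β ∈ divRoots n) (hα : α ∈ divRoots n) :
    ∃ m : ℤ, cartan β α = 2 * m := by
  obtain ⟨i, s, hs, rfl⟩ := mem_divRoots_iff.1 hα
  obtain ⟨m, hm⟩ := exists_int_coord_of_div hβ i
  obtain ⟨k, hk⟩ := hs.exists_int
  exact ⟨k * m, by rw [cartan_div _ _ hs, hm, hk]; push_cast; ring⟩

/-- The factor 4 matters in the third form: only the doubles of elements of S lie in H, and a second
factor 2 is needed to land in 2H. -/
lemma cartan_div_short {β α : E n} (hβ : β ∈ divRoots n) (hα : α ∈ shortRoots n) :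
    ∃ m : ℤ, cartan β α = 4 * m := by
  obtain ⟨i, s, hs, rfl⟩ := mem_shortRoots_iff.1 hα
  obtain ⟨m, hm⟩ := exists_int_coord_of_div hβ i
  obtain ⟨k, hk⟩ := hs.exists_int
  exact ⟨k * m, by rw [cartan_short _ _ hs, hm, hk]; push_cast; ring⟩

lemma cartan_div_long {β α : E n} (hβ : β ∈ divRoots n) (hα : α ∈ longRoots n) :
    ∃ m : ℤ, cartan β α = 2 * m := by
  obtain ⟨i, j, s, t, hij, hs, ht, rfl⟩ := mem_longRoots_iff.1 hα
  obtain ⟨m, hm⟩ := exists_int_coord_of_div hβ i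
  obtain ⟨m', hm'⟩ := exists_int_coord_of_div hβ j
  obtain ⟨k, hk⟩ := hs.exists_int
  obtain ⟨k', hk'⟩ := ht.exists_int
  exact ⟨k * m + k' * m', by rw [cartan_long _ hij hs ht, hm, hk, hm', hk']; push_cast; ring⟩

/-- The reflections in the roots are signed permutations of the standard basis. -/
lemma exists_signed_perm {α : E n} (h : α ∈ roots n) :
    ∃ (π : Equiv.Perm (Fin n)) (σ : Fin n → ℝ), (∀ k, IsSign (σ k)) ∧
      ∀ k, eps k - cartan (eps k) α • α = σ k • eps (π k) := by
  -- A reflection depends only on the line of its root, so ±ε_i and ±2ε_i all give the sign change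
  -- at i.
  have key : ∀ i : Fin n, (∀ k, cartan (eps k) α • α = (2 * (eps k : E n) i) • eps i) →
      ∃ (π : Equiv.Perm (Fin n)) (σ : Fin n → ℝ), (∀ k, IsSign (σ k)) ∧
        ∀ k, eps k - cartan (eps k) α • α = σ k • eps (π k) := by
    intro i hi
    refine ⟨1, fun k => if k = i then -1 else 1, fun k => ?_, fun k => ?_⟩
    · dsimp only; split_ifs <;> simp [IsSign]
    · rw [hi, eps_apply]
      by_cases hk : k = i
      · subst hk; simp; module
      · simp [hk, Ne.symm hk]
  rcases h with (h | h) | h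
  · obtain ⟨i, s, hs, rfl⟩ := mem_shortRoots_iff.1 h
    refine key i fun k => ?_
    rw [cartan_short _ _ hs, smul_smul]
    congr 1
    linear_combination (2 * (eps k : E n) i) * hs.mul_self
  · obtain ⟨i, j, s, t, hij, hs, ht, rfl⟩ := mem_longRoots_iff.1 h
    refine ⟨Equiv.swap i j, fun k => if k = i ∨ k = j then -(s * t) else 1,
      fun k => ?_, fun k => ?_⟩
    · dsimp only; split_ifs
      · exact (hs.mul ht).neg
      · exact isSign_one
    · rw [cartan_long _ hij hs ht]
      by_cases hi : k = i
      · subst hi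
        simp only [eps_apply, hij.symm, if_true, if_false, true_or, Equiv.swap_apply_left]
        have := hs.mul_self
        rw [smul_add, smul_smul, smul_smul,
          show (s * 1 + t * 0) * s = 1 by linarith]
        module
      · by_cases hj : k = j
        · subst hj
          simp only [eps_apply, hij, if_true, if_false, or_true, Equiv.swap_apply_right]
          have := ht.mul_self
          rw [smul_add, smul_smul, smul_smul,
            show (s * 0 + t * 1) * t = 1 by linarith]
          module
        · simp [eps_apply, hi, hj, Ne.symm hi, Ne.symm hj, Equiv.swap_apply_of_ne_of_ne hi hj]
  · obtain ⟨i, s, hs, rfl⟩ := mem_divRoots_iff.1 h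
    refine key i fun k => ?_
    rw [cartan_div _ _ hs, smul_smul]
    congr 1
    linear_combination (2 * (eps k : E n) i) * hs.mul_self

lemma reflect_smul (c : ℝ) (v α : E n) :
    c • v - cartan (c • v) α • α = c • (v - cartan v α • α) := by
  rw [cartan_smul]; module

lemma reflect_add (u v α : E n) :
    u + v - cartan (u + v) α • α = (u - cartan u α • α) + (v - cartan v α • α) := by
  rw [cartan_add]; module

lemma reflect_short {α β : E n} (hα : α ∈ roots n) (hβ : β ∈ shortRoots n) :
    β - cartan β α • α ∈ shortRoots n := by
  obtain ⟨π, σ, hσ, h⟩ := exists_signed_perm hα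
  obtain ⟨i, s, hs, rfl⟩ := mem_shortRoots_iff.1 hβ
  rw [reflect_smul, h, smul_smul]
  exact mem_shortRoots_iff.2 ⟨π i, _, hs.mul (hσ i), rfl⟩

lemma reflect_div {α β : E n} (hα : α ∈ roots n) (hβ : β ∈ divRoots n) :
    β - cartan β α • α ∈ divRoots n := by
  obtain ⟨π, σ, hσ, h⟩ := exists_signed_perm hα
  obtain ⟨i, s, hs, rfl⟩ := mem_divRoots_iff.1 hβ
  rw [reflect_smul, h, smul_smul, mul_assoc]
  exact mem_divRoots_iff.2 ⟨π i, _, hs.mul (hσ i), rfl⟩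

lemma reflect_long {α β : E n} (hα : α ∈ roots n) (hβ : β ∈ longRoots n) :
    β - cartan β α • α ∈ longRoots n := by
  obtain ⟨π, σ, hσ, h⟩ := exists_signed_perm hα
  obtain ⟨i, j, s, t, hij, hs, ht, rfl⟩ := mem_longRoots_iff.1 hβ
  rw [reflect_add, reflect_smul, reflect_smul, h, h, smul_smul, smul_smul]
  exact mem_longRoots_iff.2
    ⟨π i, π j, _, _, fun e => hij (π.injective e), hs.mul (hσ i), ht.mul (hσ j), rfl⟩

lemma reflect_B {α β : E n} (hα : α ∈ roots n) (hβ : β ∈ shortRoots n ∪ longRoots n) :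
    β - cartan β α • α ∈ shortRoots n ∪ longRoots n :=
  hβ.imp (reflect_short hα) (reflect_long hα)

/-- Any two divisible roots are equal, opposite, or exchanged by the reflection in a long root. -/
lemma div_connected {α β : E n} (hα : α ∈ divRoots n) (hβ : β ∈ divRoots n) :
    β = α ∨ β = α - cartan α α • α ∨ ∃ γ ∈ longRoots n, β = α - cartan α γ • γ := by
  obtain ⟨i, s, hs, rfl⟩ := mem_divRoots_iff.1 hα
  obtain ⟨j, t, ht, rfl⟩ := mem_divRoots_iff.1 hβ
  by_cases hij : i = j
  · subst hij
    by_cases hst : t = s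
    · left; rw [hst]
    · have : t = -s := by
        rcases hs with rfl | rfl <;> rcases ht with rfl | rfl <;> simp_all
      right; left
      rw [cartan_div _ _ hs, this]
      simp only [PiLp.smul_apply, eps_apply, if_true, smul_eq_mul]
      rw [show s * (2 * s * 1) = 2 by linarith [hs.mul_self]]
      module
  · right; right
    refine ⟨s • eps i + (-t) • eps j,
      mem_longRoots_iff.2 ⟨i, j, s, -t, hij, hs, ht.neg, rfl⟩, ?_⟩
    rw [cartan_long _ hij hs ht.neg]
    simp only [PiLp.smul_apply, eps_apply, if_true, smul_eq_mul, Ne.symm hij, if_false]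
    rw [show s * (2 * s * 1) + -t * (2 * s * 0) = 2 by linarith [hs.mul_self]]
    module

/-- For a divisible root `α` there is a long root `β` with `(β, α^∨) = 1`. -/
lemma exists_long_cartan_div (hn : 2 ≤ n) {α : E n} (hα : α ∈ divRoots n) :
    ∃ β ∈ longRoots n, cartan β α = 1 := by
  obtain ⟨i, s, hs, rfl⟩ := mem_divRoots_iff.1 hα
  have : Nontrivial (Fin n) := Fin.nontrivial_iff_two_le.2 hn
  obtain ⟨j, hj⟩ := exists_ne i
  refine ⟨s • eps i + (1 : ℝ) • eps j,
    mem_longRoots_iff.2 ⟨i, j, s, 1, hj.symm, hs, isSign_one, rfl⟩, ?_⟩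
  rw [cartan_div _ _ hs]
  simp [eps_apply, hj.symm, hs.mul_self]

end Finite

/-! ### Real-linear sections -/

section Sections

variable {n : ℕ} {Y : Type*} [AddCommGroup Y] [Module ℝ Y]

/-- The linear map `V → Y` sending `ε_i` to `x_i`. -/
noncomputable def linSection (x : Fin n → Y) : E n →ₗ[ℝ] Y :=
  ∑ i, (LinearMap.toSpanSingleton ℝ Y (x i)).comp (EuclideanSpace.projₗ i)

lemma linSection_eps (x : Fin n → Y) (i : Fin n) : linSection x (eps i) = x i := by
  simp [linSection, eps_apply]

lemma isIntLinearOn_linearMap (R : Set (E n)) (f : E n →ₗ[ℝ] Y) : IsIntLinearOn R f :=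
  ⟨f.toAddMonoidHom.comp (AddSubgroup.closure R).subtype, fun _ _ => rfl⟩

lemma IsIntLinearOn.eq_linSection {p : E n → Y}
    (hp : IsIntLinearOn (shortRoots n ∪ longRoots n) p) {α : E n}
    (hα : α ∈ shortRoots n ∪ longRoots n) : p α = linSection (fun i => p (eps i)) α := by
  obtain ⟨f, hf⟩ := hp
  have hs : ∀ i, (eps i : E n) ∈ shortRoots n ∪ longRoots n := fun i => Or.inl ⟨i, Or.inl rfl⟩
  have hf' : ∀ i, p (eps i) = f ⟨eps i, AddSubgroup.subset_closure (hs i)⟩ := fun i => hf _ (hs i)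
  rw [hf α hα]
  rcases hα with ⟨i, rfl | rfl⟩ | ⟨i, j, -, rfl | rfl | rfl | rfl⟩ <;>
    simp only [map_add, map_sub, map_neg, linSection_eps, hf'] <;>
    simp only [← map_add, ← map_sub, ← map_neg] <;> rfl

/-- The linear map `linSection x` corrected by the vector `a`: it sends `ε_i` to `x_i - a / 2`. -/
noncomputable def shiftSection (x : Fin n → Y) (a : Y) : E n →ₗ[ℝ] Y :=
  linSection fun i => x i - (1 / 2 : ℝ) • a

lemma shiftSection_eps (x : Fin n → Y) (a : Y) (i : Fin n) :
    shiftSection x a (eps i) = x i - (1 / 2 : ℝ) • a := linSection_eps _ i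

/-- A short root has coordinate sum ±1, so its value changes by ±a/2 and must be doubled. Long and
divisible roots have even coordinate sum, which makes their change an integer multiple of a. -/
lemma two_smul_sub_shiftSection_of_short (x : Fin n → Y) (a : Y) {α : E n}
    (hα : α ∈ shortRoots n) :
    ∃ m : ℤ, (2 : ℝ) • (linSection x α - shiftSection x a α) = m • a := by
  obtain ⟨i, s, hs, rfl⟩ := mem_shortRoots_iff.1 hα
  obtain ⟨m, rfl⟩ := hs.exists_int
  refine ⟨m, ?_⟩
  rw [map_smul, map_smul, linSection_eps, shiftSection_eps, ← Int.cast_smul_eq_zsmul ℝ m]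
  module

lemma sub_shiftSection_of_long (x : Fin n → Y) (a : Y) {α : E n} (hα : α ∈ longRoots n) :
    ∃ m : ℤ, linSection x α - shiftSection x a α = m • a := by
  obtain ⟨i, j, -, rfl | rfl | rfl | rfl⟩ := hα
  · exact ⟨1, by simp only [map_add, linSection_eps, shiftSection_eps]; module⟩
  · exact ⟨0, by simp only [map_sub, linSection_eps, shiftSection_eps]; module⟩
  · exact ⟨0, by simp only [map_add, map_neg, linSection_eps, shiftSection_eps]; module⟩
  · exact ⟨-1, by simp only [map_sub, map_neg, linSection_eps, shiftSection_eps]; module⟩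

lemma sub_shiftSection_of_div (x : Fin n → Y) (a : Y) {α : E n} (hα : α ∈ divRoots n) :
    ∃ m : ℤ, linSection x α - shiftSection x a α = m • a := by
  obtain ⟨i, rfl | rfl⟩ := hα
  · exact ⟨1, by simp only [map_smul, linSection_eps, shiftSection_eps]; module⟩
  · exact ⟨-1, by simp only [map_neg, map_smul, linSection_eps, shiftSection_eps]; module⟩

end Sections

lemma mem_vadd_iff_sub_mem {Y : Type*} [AddCommGroup Y] {a x : Y} {T : Set Y} : x ∈ a +ᵥ T ↔ x - a ∈ T := by
  rw [Set.mem_vadd_set_iff_neg_vadd_mem, vadd_eq_add, neg_add_eq_sub]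

/-! ### Root subsystems, their linear sections, and the maximality argument. -/

section Subsystems

variable {n : ℕ} {Y : Type*} [AddCommGroup Y] [Module ℝ Y]

lemma reflection_mk (α β : E n) (y x : Y) :
    reflection (α, y) (β, x) = (β - cartan β α • α, x - cartan β α • y) := rfl

lemma IsRootSubsystem.reflect_mem {Φ Ψ : Set (E n × Y)} (h : IsRootSubsystem Φ Ψ) {α β : E n}
    {x y : Y} (ha : (α, y) ∈ Ψ) (hb : (β, x) ∈ Ψ) :
    (β - cartan β α • α, x - cartan β α • y) ∈ Ψ := h.2.2 _ ha _ hb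

/-- The values of a linear section at the roots where it selects an element of the subsystem
form a set of roots closed under reflections. -/
lemma IsRootSubsystem.section_reflect {Φ Ψ : Set (E n × Y)} (h : IsRootSubsystem Φ Ψ)
    (q : E n →ₗ[ℝ] Y) {α β : E n} (ha : (α, q α) ∈ Ψ) (hb : (β, q β) ∈ Ψ) :
    (β - cartan β α • α, q (β - cartan β α • α)) ∈ Ψ := by
  rw [map_sub, map_smul]
  exact h.reflect_mem ha hb

/-- A linear section over the simple roots of type `C_n` is a section over all the long and
divisible roots. -/
lemma IsRootSubsystem.section_of_simple {Φ Ψ : Set (E n × Y)} (h : IsRootSubsystem Φ Ψ)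
    (q : E n →ₗ[ℝ] Y)
    (hl : ∀ i j : Fin n, i ≠ j → (eps i - eps j, q (eps i - eps j)) ∈ Ψ)
    (N : Fin n) (hN : ((2 : ℝ) • eps N, q ((2 : ℝ) • eps N)) ∈ Ψ)
    {α : E n} (hα : α ∈ longRoots n ∪ divRoots n) : (α, q α) ∈ Ψ := by
  -- The roots where q selects an element of `Ψ` are closed under their own reflections; ε_N − ε_i
  -- carries 2ε_N to 2ε_i, and sign changes then give the rest.
  have hpos : ∀ i : Fin n, ((2 : ℝ) • eps i, q ((2 : ℝ) • eps i)) ∈ Ψ := by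
    intro i
    by_cases hi : N = i
    · exact hi ▸ hN
    · have key := h.section_reflect q (hl N i hi) hN
      have e : (2 : ℝ) • eps N - cartan ((2 : ℝ) • eps N) (eps N - eps i) • (eps N - eps i)
          = ((2 : ℝ) • eps i : E n) := by
        have := cartan_long ((2 : ℝ) • eps N) hi isSign_one isSign_one.neg
        rw [one_smul, neg_one_smul, ← sub_eq_add_neg] at this
        rw [this]
        simp only [PiLp.smul_apply, eps_apply, if_true, Ne.symm hi, if_false]
        module
      rwa [e] at key
  have hcd : ∀ (β : E n) (i : Fin n), cartan β ((2 : ℝ) • eps i) = β i := fun β i => by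
    simpa using cartan_div β i isSign_one
  have hsum : ∀ i j : Fin n, i ≠ j → (eps i + eps j, q (eps i + eps j)) ∈ Ψ := by
    intro i j hij
    have key := h.section_reflect q (hpos j) (hl i j hij)
    have e : eps i - eps j - cartan (eps i - eps j) ((2 : ℝ) • eps j) • (2 : ℝ) • eps j
        = (eps i + eps j : E n) := by
      rw [hcd]
      simp only [PiLp.sub_apply, eps_apply, if_true, Ne.symm hij, if_false]
      module
    rwa [e] at key
  rcases hα with ⟨i, j, hij, rfl | rfl | rfl | rfl⟩ | ⟨i, rfl | rfl⟩
  · exact hsum i j hij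
  · exact hl i j hij
  · rw [neg_add_eq_sub]; exact hl j i hij.symm
  · have key := h.section_reflect q (hpos i) (hl i j hij)
    have e : eps i - eps j - cartan (eps i - eps j) ((2 : ℝ) • eps i) • (2 : ℝ) • eps i
        = (-eps i - eps j : E n) := by
      rw [hcd]
      simp only [PiLp.sub_apply, eps_apply, if_true, hij, if_false]
      module
    rwa [e] at key
  · exact hpos i
  · have key := h.section_reflect q (hpos i) (hpos i)
    have e : (2 : ℝ) • eps i - cartan ((2 : ℝ) • eps i) ((2 : ℝ) • eps i) • (2 : ℝ) • eps i
        = (-((2 : ℝ) • eps i) : E n) := by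
      rw [hcd]
      simp only [PiLp.smul_apply, eps_apply, if_true]
      module
    rwa [e] at key

namespace ExtensionDatum

variable (D : ExtensionDatum n Y)

lemma subset_Λs {α : E n} (hα : α ∈ shortRoots n) : D.Λ α ⊆ D.Λs :=
  Set.subset_biUnion_of_mem hα

lemma subset_Λl {α : E n} (hα : α ∈ longRoots n) : D.Λ α ⊆ D.Λl :=
  Set.subset_biUnion_of_mem hα

lemma Λ_div_subset {α β : E n} (hα : α ∈ divRoots n) (hβ : β ∈ divRoots n) :
    D.Λ α ⊆ D.Λ β := by
  intro x hx
  rcases div_connected hα hβ with rfl | h | ⟨γ, hγ, h⟩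
  · exact hx
  · obtain ⟨i, s, hs, hi⟩ := mem_divRoots_iff.1 hα
    -- Zero need not lie in Λ_α, so the sign change is performed with the short root α/2, where it
    -- does.
    have hσ : s • eps i ∈ shortRoots n := mem_shortRoots_iff.2 ⟨i, s, hs, rfl⟩
    have := D.sub_mem _ (mem_roots_of_short hσ) _ (mem_roots_of_div hα) x hx 0
      (D.zero_mem _ (Or.inl (Or.inl hσ)))
    rw [smul_zero, sub_zero] at this
    convert this using 2
    rw [h, hi, cartan_div _ _ hs, cartan_short _ _ hs]
    module
  · have := D.sub_mem _ (mem_roots_of_long hγ) _ (mem_roots_of_div hα) x hx 0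
      (D.zero_mem _ (Or.inl (Or.inr hγ)))
    rwa [smul_zero, sub_zero, ← h] at this

lemma Λd_eq {α : E n} (hα : α ∈ divRoots n) : D.Λd = D.Λ α :=
  Set.Subset.antisymm (Set.iUnion₂_subset fun _ hβ => D.Λ_div_subset hβ hα)
    (Set.subset_biUnion_of_mem hα)

/-- This is the extension axiom at 0 ∈ Λ_β; inclusions between Λ_s, Λ_ℓ and Λ_d follow by choosing
pairs with a suitable Cartan number. -/
lemma neg_smul_mem_Λl {α β : E n} {y : Y} (hα : α ∈ roots n) (hy : y ∈ D.Λ α)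
    (hβ : β ∈ longRoots n) : -(cartan β α • y) ∈ D.Λl := by
  have := D.sub_mem α hα β (mem_roots_of_long hβ) 0 (D.zero_mem _ (Or.inl (Or.inr hβ))) y hy
  rw [zero_sub] at this
  exact D.subset_Λl (reflect_long hα hβ) this

lemma neg_smul_mem_Λs {α β : E n} {y : Y} (hα : α ∈ roots n) (hy : y ∈ D.Λ α)
    (hβ : β ∈ shortRoots n) : -(cartan β α • y) ∈ D.Λs := by
  have := D.sub_mem α hα β (mem_roots_of_short hβ) 0 (D.zero_mem _ (Or.inl (Or.inl hβ))) y hy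
  rw [zero_sub] at this
  exact D.subset_Λs (reflect_short hα hβ) this

lemma mem_inter_ΦB {Ψ : Set (E n × Y)} (hΨ : Ψ ⊆ D.Φ) {α : E n}
    (hα : α ∈ shortRoots n ∪ longRoots n) {y : Y} (h : (α, y) ∈ Ψ) : (α, y) ∈ Ψ ∩ D.ΦB :=
  ⟨h, hα, (hΨ h).2⟩

/-- If the divisible part of a maximal subsystem `Ψ` can be replaced by sets `Z_α` containing it
in a way that is compatible with the reflections, then `Ψ` has the divisible part `Z`. -/
lemma eq_inter_union_piece {Ψ : Set (E n × Y)} (hΨ : IsMaximalRootSubsystem D.Φ Ψ)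
    (hB : Ψ ∩ D.ΦB ≠ D.ΦB) (Z : E n → Set Y)
    (hΨZ : ∀ α ∈ divRoots n, fiber Ψ α ⊆ Z α) (hZΛ : ∀ α ∈ divRoots n, Z α ⊆ D.Λ α)
    (hdB : ∀ β ∈ divRoots n, ∀ x ∈ Z β, ∀ α ∈ shortRoots n ∪ longRoots n, ∀ y, (α, y) ∈ Ψ →
      x - cartan β α • y ∈ Z (β - cartan β α • α))
    (hdd : ∀ β ∈ divRoots n, ∀ x ∈ Z β, ∀ α ∈ divRoots n, ∀ y ∈ Z α,
      x - cartan β α • y ∈ Z (β - cartan β α • α))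
    (hBd : ∀ β ∈ shortRoots n ∪ longRoots n, ∀ x, (β, x) ∈ Ψ → ∀ α ∈ divRoots n, ∀ y ∈ Z α,
      (β - cartan β α • α, x - cartan β α • y) ∈ Ψ) :
    Ψ = (Ψ ∩ D.ΦB) ∪ piece (divRoots n) Z := by
  obtain ⟨hsub, -, hmax⟩ := hΨ
  have hle : Ψ ⊆ (Ψ ∩ D.ΦB) ∪ piece (divRoots n) Z := by
    rintro ⟨α, y⟩ h
    rcases (hsub.2.1 h).1 with hα | hα
    · exact Or.inl (D.mem_inter_ΦB hsub.2.1 hα h)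
    · exact Or.inr ⟨hα, hΨZ α hα h⟩
  refine hmax _ ⟨hsub.1.mono hle, ?_, ?_⟩ ?_ hle
  · rintro ⟨α, y⟩ (h | h)
    · exact hsub.2.1 h.1
    · exact ⟨mem_roots_of_div h.1, hZΛ α h.1 h.2⟩
  · rintro ⟨α, y⟩ ha ⟨β, x⟩ hb
    rw [reflection_mk]
    rcases hb with hb | hb
    · left
      have hβ : β ∈ shortRoots n ∪ longRoots n := hb.2.1
      rcases ha with ha | ha
      · exact D.mem_inter_ΦB hsub.2.1 (reflect_B (hsub.2.1 ha.1).1 hβ)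
          (hsub.reflect_mem ha.1 hb.1)
      · exact D.mem_inter_ΦB hsub.2.1 (reflect_B (mem_roots_of_div ha.1) hβ)
          (hBd β hβ x hb.1 α ha.1 y ha.2)
    · right
      rcases ha with ha | ha
      · exact ⟨reflect_div (hsub.2.1 ha.1).1 hb.1, hdB β hb.1 x hb.2 α ha.2.1 y ha.1⟩
      · exact ⟨reflect_div (mem_roots_of_div ha.1) hb.1, hdd β hb.1 x hb.2 α ha.1 y ha.2⟩
  -- Z lives over divisible roots only, so equality with Φ would make the B-part of `Ψ` all of Φ_B.
  · intro hΦ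
    refine hB (Set.Subset.antisymm Set.inter_subset_right fun ⟨α, y⟩ h => ?_)
    have : (α, y) ∈ (Ψ ∩ D.ΦB) ∪ piece (divRoots n) Z := hΦ ▸ ⟨Or.inl h.1, h.2⟩
    exact this.resolve_right fun h' => not_div_of_B h.1 h'.1

/-- The case where the whole divisible part of `Φ` can be added. -/
lemma eq_inter_union_piece_Λd {Ψ : Set (E n × Y)} (hΨ : IsMaximalRootSubsystem D.Φ Ψ)
    (hB : Ψ ∩ D.ΦB ≠ D.ΦB)
    (hBd : ∀ β ∈ shortRoots n ∪ longRoots n, ∀ x, (β, x) ∈ Ψ → ∀ α ∈ divRoots n, ∀ y ∈ D.Λ α,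
      (β - cartan β α • α, x - cartan β α • y) ∈ Ψ) :
    Ψ = (Ψ ∩ D.ΦB) ∪ piece (divRoots n) (fun _ => D.Λd) := by
  have hsub := hΨ.1.2.1
  have : piece (divRoots n) (fun _ => D.Λd) = piece (divRoots n) D.Λ := by
    ext ⟨α, y⟩
    exact and_congr_right fun hα => by rw [D.Λd_eq hα]
  rw [this]
  exact D.eq_inter_union_piece hΨ hB D.Λ (fun α _ y h => (hsub h).2) (fun _ _ => subset_rfl)
    (fun β hβ x hx α _ y h => D.sub_mem α (hsub h).1 β (mem_roots_of_div hβ) x hx y (hsub h).2)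
    (fun β hβ x hx α hα y h => D.sub_mem α (mem_roots_of_div hα) β (mem_roots_of_div hβ) x hx y h)
    hBd

section Fibers

variable {D} {Ψ : Set (E n × Y)} {U W : E n → Set Y}

lemma mem_iff_of_short (hΨ : Ψ ⊆ D.Φ)
    (h : Ψ ∩ D.ΦB = piece (shortRoots n) U ∪ piece (longRoots n) W) {α : E n}
    (hα : α ∈ shortRoots n) {y : Y} : (α, y) ∈ Ψ ↔ y ∈ U α := by
  constructor
  · intro hy
    have := D.mem_inter_ΦB hΨ (Or.inl hα) hy
    rw [h] at this
    rcases this with h' | h'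
    · exact h'.2
    · exact absurd h'.1 (not_long_of_short hα)
  · intro hy
    have : (α, y) ∈ Ψ ∩ D.ΦB := h ▸ Or.inl ⟨hα, hy⟩
    exact this.1

lemma mem_iff_of_long (hΨ : Ψ ⊆ D.Φ)
    (h : Ψ ∩ D.ΦB = piece (shortRoots n) U ∪ piece (longRoots n) W) {α : E n}
    (hα : α ∈ longRoots n) {y : Y} : (α, y) ∈ Ψ ↔ y ∈ W α := by
  constructor
  · intro hy
    have := D.mem_inter_ΦB hΨ (Or.inr hα) hy
    rw [h] at this
    rcases this with h' | h'
    · exact absurd hα (not_long_of_short h'.1)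
    · exact h'.2
  · intro hy
    have : (α, y) ∈ Ψ ∩ D.ΦB := h ▸ Or.inr ⟨hα, hy⟩
    exact this.1

end Fibers

end ExtensionDatum

/-- If the long fibres of a subsystem are cosets `P_α + H`, so are the divisible ones, up to
taking subsets. -/
lemma IsRootSubsystem.sub_mem_of_div (hn : 2 ≤ n) {Φ Ψ : Set (E n × Y)}
    (h : IsRootSubsystem Φ Ψ) {H : AddSubgroup Y} (P : E n →ₗ[ℝ] Y)
    (hl : ∀ α ∈ longRoots n, ∀ y, (α, y) ∈ Ψ ↔ y - P α ∈ H) {α : E n} (hα : α ∈ divRoots n)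
    {y : Y} (hy : (α, y) ∈ Ψ) : y - P α ∈ H := by
  obtain ⟨β, hβ, hc⟩ := exists_long_cartan_div hn hα
  have hP : (β, P β) ∈ Ψ := (hl β hβ _).2 (by simp)
  -- Since (β, α^∨) = 1, the reflected root is (β − α) ⊕ (P_β − y), again long, so P_β − y ∈ P_{β−α}
  -- + H.
  have := (hl _ (reflect_long (mem_roots_of_div hα) hβ) _).1 (h.reflect_mem hy hP)
  rw [hc, one_smul, one_smul, map_sub] at this
  rw [← neg_mem_iff]
  convert this using 1
  abel

end Subsystems

/-- A set stable under translation by a symmetric set is stable under translation by the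
multiples of its elements. -/
lemma IsUnionOfCosets.add_zsmul_mem {Y : Type*} [AddCommGroup Y] {G M T : Set Y}
    (h : IsUnionOfCosets G M T) (hG : ∀ g ∈ G, -g ∈ G) {g : Y} (hg : g ∈ G) (m : ℤ) :
    ∀ t ∈ T, t + m • g ∈ T := by
  induction m with
  | zero => simp
  | succ k ih =>
    intro t ht
    rw [add_zsmul, one_zsmul, ← add_assoc]
    exact h.2 _ (ih t ht) _ hg
  | pred k ih =>
    intro t ht
    rw [sub_zsmul, one_zsmul, ← add_assoc]
    exact h.2 _ (ih t ht) _ (hG _ hg)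

lemma exists_short_of_div {n : ℕ} {α : E n} (hα : α ∈ divRoots n) :
    ∃ γ ∈ shortRoots n, α = (2 : ℝ) • γ := by
  obtain ⟨i, s, hs, rfl⟩ := mem_divRoots_iff.1 hα
  exact ⟨s • eps i, mem_shortRoots_iff.2 ⟨i, s, hs, rfl⟩, (smul_smul _ _ _).symm⟩

/-! ### Inclusions in the extension datum, and the first two forms. -/

section Forms

variable {n : ℕ} {Y : Type*} [AddCommGroup Y] [Module ℝ Y]

namespace ExtensionDatum

variable {D : ExtensionDatum n Y} {Ψ : Set (E n × Y)}

lemma neg_mem_Λl_of_div (hn : 2 ≤ n) {α : E n} (hα : α ∈ divRoots n) {y : Y} (hy : y ∈ D.Λ α) :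
    -y ∈ D.Λl := by
  obtain ⟨β, hβ, hc⟩ := exists_long_cartan_div hn hα
  simpa [hc] using D.neg_smul_mem_Λl (mem_roots_of_div hα) hy hβ

lemma neg_mem_Λ_of_div {α : E n} (hα : α ∈ divRoots n) {y : Y} (hy : y ∈ D.Λ α) :
    -y ∈ D.Λ α := by
  have hc : cartan α α = 2 := by
    rw [cartan, inner_self_of_div hα]; norm_num
  have h := D.sub_mem α (mem_roots_of_div hα) α (mem_roots_of_div hα) y hy y hy
  rw [hc] at h
  have h' : α - (2 : ℝ) • α ∈ divRoots n := hc ▸ reflect_div (mem_roots_of_div hα) hα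
  have := D.Λ_div_subset h' hα h
  rwa [show y - (2 : ℝ) • y = -y by module] at this

lemma mem_Λl_of_div (hn : 2 ≤ n) {α : E n} (hα : α ∈ divRoots n) {y : Y} (hy : y ∈ D.Λ α) :
    y ∈ D.Λl := by
  simpa using neg_mem_Λl_of_div hn hα (neg_mem_Λ_of_div hα hy)

/-- `2 Λ_s ⊆ Λ_ℓ`. -/
lemma two_smul_mem_Λl_of_short (hn : 2 ≤ n) {α : E n} (hα : α ∈ shortRoots n) {y : Y}
    (hy : y ∈ D.Λ α) : (2 : ℝ) • y ∈ D.Λl := by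
  obtain ⟨i, s, hs, rfl⟩ := mem_shortRoots_iff.1 hα
  have : Nontrivial (Fin n) := Fin.nontrivial_iff_two_le.2 hn
  obtain ⟨j, hj⟩ := exists_ne i
  have hβ : (-s) • eps i + (1 : ℝ) • eps j ∈ longRoots n :=
    mem_longRoots_iff.2 ⟨i, j, -s, 1, hj.symm, hs.neg, isSign_one, rfl⟩
  have := D.neg_smul_mem_Λl (mem_roots_of_short hα) hy hβ
  rw [cartan_short _ _ hs] at this
  simp only [PiLp.add_apply, PiLp.smul_apply, smul_eq_mul, eps_apply, if_true, hj.symm,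
    if_false] at this
  rw [show 2 * (s * (-s * 1 + 1 * 0)) = (-2 : ℝ) by linarith [hs.mul_self]] at this
  simpa using this

/-- `Λ_ℓ ⊆ Λ_s`. -/
lemma mem_Λs_of_long {α : E n} (hα : α ∈ longRoots n) {y : Y} (hy : y ∈ D.Λ α) : y ∈ D.Λs := by
  obtain ⟨i, j, s, t, hij, hs, ht, rfl⟩ := mem_longRoots_iff.1 hα
  have hβ : (-s) • eps i ∈ shortRoots n := mem_shortRoots_iff.2 ⟨i, -s, hs.neg, rfl⟩
  have := D.neg_smul_mem_Λs (mem_roots_of_long hα) hy hβ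
  rw [cartan_long _ hij hs ht] at this
  simp only [PiLp.smul_apply, smul_eq_mul, eps_apply, if_true, hij.symm, if_false] at this
  rw [show s * (-s * 1) + t * (-s * 0) = (-1 : ℝ) by linarith [hs.mul_self]] at this
  simpa using this

lemma neg_mem_Λl {y : Y} (hy : y ∈ D.Λl) : -y ∈ D.Λl := by
  obtain ⟨α, hα, hy⟩ := Set.mem_iUnion₂.1 hy
  have hc : cartan α α = 2 := by
    rw [cartan, inner_self_of_long hα]; norm_num
  have h := D.sub_mem α (mem_roots_of_long hα) α (mem_roots_of_long hα) y hy y hy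
  have := D.subset_Λl (reflect_long (mem_roots_of_long hα) hα) h
  rwa [hc, show y - (2 : ℝ) • y = -y by module] at this

lemma formOne_eq (hn : 2 ≤ n) (hΨ : IsMaximalRootSubsystem D.Φ Ψ) (hB : Ψ ∩ D.ΦB ≠ D.ΦB)
    {p : E n → Y} {S : Set Y} (h : D.FormOne p S (Ψ ∩ D.ΦB)) :
    Ψ = (Ψ ∩ D.ΦB) ∪ piece (divRoots n) (fun _ => D.Λd) := by
  obtain ⟨-, hp, hS, hform⟩ := h
  have hsub := hΨ.1.2.1
  set P := linSection fun i => p (eps i) with hP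
  have hpP : ∀ α ∈ shortRoots n ∪ longRoots n, p α = P α := fun α hα => hp.1.eq_linSection hα
  have hs : ∀ α ∈ shortRoots n, ∀ y, (α, y) ∈ Ψ ↔ y - P α ∈ S := fun α hα y => by
    rw [mem_iff_of_short hsub hform hα, mem_vadd_iff_sub_mem, hpP α (Or.inl hα)]
  refine D.eq_inter_union_piece_Λd hΨ hB fun β hβ x hx α hα y hy => ?_
  have hα' := mem_roots_of_div hα
  rcases hβ with hβ | hβ
  · rw [hs _ (reflect_short hα' hβ)]
    rw [hs _ hβ] at hx
    obtain ⟨m, hm⟩ := cartan_B_div (Or.inl hβ) hα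
    obtain ⟨γ, hγ, rfl⟩ := exists_short_of_div hα
    have hPγ : P γ ∈ D.Λ γ := hpP γ (Or.inl hγ) ▸ (hsub (hp.2 γ (Or.inl hγ)).1).2
    -- Writing α = 2γ and m for the Cartan number, the fibre moves by m(2P_γ) − my; both 2P_γ and −y
    -- lie in Λ_ℓ, which preserves S.
    have h1 := hS.prop.1.add_zsmul_mem (fun _ => neg_mem_Λl)
      (two_smul_mem_Λl_of_short hn hγ hPγ) m _ hx
    have h2 := hS.prop.1.add_zsmul_mem (fun _ => neg_mem_Λl) (neg_mem_Λl_of_div hn hα hy) m _ h1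
    convert h2 using 1
    rw [hm, map_sub, map_smul, map_smul, ← Int.cast_smul_eq_zsmul ℝ m,
      ← Int.cast_smul_eq_zsmul ℝ m]
    module
  · rw [mem_iff_of_long hsub hform (reflect_long hα' hβ)]
    exact D.subset_Λl (reflect_long hα' hβ) (D.sub_mem α hα' β (mem_roots_of_long hβ) x
      (hsub hx).2 y hy)

/-- If the long fibres of `Ψ` are the cosets `P_α + H`, a suitable shift of `P` by an element
of `H` is a section over the long and divisible roots. -/
lemma exists_shiftSection (hn : 2 ≤ n) (hΨ : IsRootSubsystem D.Φ Ψ) (hGr : D.Gr Ψ = roots n)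
    {H : AddSubgroup Y} (x : Fin n → Y)
    (hl : ∀ α ∈ longRoots n, ∀ y, (α, y) ∈ Ψ ↔ y - linSection x α ∈ H) :
    ∃ a ∈ H, ∀ α ∈ longRoots n ∪ divRoots n, (α, shiftSection x a α) ∈ Ψ := by
  let N : Fin n := ⟨n - 1, by omega⟩
  have hdN : (2 : ℝ) • eps N ∈ divRoots n := ⟨N, Or.inl rfl⟩
  obtain ⟨-, c, -, hc⟩ : (2 : ℝ) • eps N ∈ D.Gr Ψ := hGr ▸ mem_roots_of_div hdN
  have hcH := hΨ.sub_mem_of_div hn (linSection x) hl hdN hc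
  rw [map_smul, linSection_eps] at hcH
  -- This a makes the shifted section take the value c at 2ε_N, since 2(x_N − a/2) = c. `N` is the
  -- last index, counted from zero.
  refine ⟨(2 : ℝ) • x N - c, by simpa using H.neg_mem hcH, fun α hα => ?_⟩
  refine hΨ.section_of_simple _ (fun i j hij => ?_) N ?_ hα
  · rw [hl _ ⟨i, j, hij, Or.inr (Or.inl rfl)⟩]
    simp [linSection_eps, shiftSection_eps]
  · convert hc using 2
    rw [map_smul, shiftSection_eps]
    module

lemma isSectionC (hn : 2 ≤ n) (hΨ : Ψ ⊆ D.Φ) (Q : E n →ₗ[ℝ] Y)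
    (hQ : ∀ α ∈ longRoots n ∪ divRoots n, (α, Q α) ∈ Ψ) : D.IsSectionC Q Ψ := by
  refine ⟨isIntLinearOn_linearMap _ Q, fun α hα => ⟨?_, hQ α hα⟩⟩
  have h := (hΨ (hQ α hα)).2
  rcases hα with hα | hα
  · exact D.subset_Λl hα h
  · exact mem_Λl_of_div hn hα h

lemma formTwo_eq (hn : 2 ≤ n) (hΨ : IsMaximalRootSubsystem D.Φ Ψ) (hGr : D.Gr Ψ = roots n)
    (hB : Ψ ∩ D.ΦB ≠ D.ΦB) {p : E n → Y} {H : AddSubgroup Y}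
    (h : D.FormTwo p H (Ψ ∩ D.ΦB)) :
    ∃ q : E n → Y, D.IsSectionC q Ψ ∧
      Ψ = (Ψ ∩ D.ΦB) ∪ piece (divRoots n) (fun α => (q α +ᵥ (H : Set Y)) ∩ D.Λd) := by
  obtain ⟨-, hp, -, h2, hform⟩ := h
  have hsub := hΨ.1.2.1
  set P := linSection fun i => p (eps i) with hP
  have hpP : ∀ α ∈ shortRoots n ∪ longRoots n, p α = P α := fun α hα => hp.1.eq_linSection hα
  have hl : ∀ α ∈ longRoots n, ∀ y, (α, y) ∈ Ψ ↔ y - P α ∈ H := fun α hα y => by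
    rw [mem_iff_of_long hsub hform hα, mem_vadd_iff_sub_mem, hpP α (Or.inr hα), SetLike.mem_coe]
  have h2' : ∀ x ∈ D.Λs, (2 : ℝ) • x ∈ H := fun x hx => by
    have := h2 x hx
    rwa [← Int.cast_smul_eq_zsmul ℝ, Int.cast_ofNat] at this
  have hPd : ∀ α ∈ divRoots n, P α ∈ H := fun α hα => by
    obtain ⟨γ, hγ, rfl⟩ := exists_short_of_div hα
    rw [map_smul]
    exact h2' _ (hpP γ (Or.inl hγ) ▸ D.subset_Λs hγ (hsub (hp.2 γ (Or.inl hγ)).1).2)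
  have hdiv : ∀ α ∈ divRoots n, ∀ y, (α, y) ∈ Ψ → y ∈ H := fun α hα y hy => by
    simpa using H.add_mem (hΨ.1.sub_mem_of_div hn P hl hα hy) (hPd α hα)
  obtain ⟨a, -, hQ⟩ := exists_shiftSection hn hΨ.1 hGr _ hl
  refine ⟨shiftSection (fun i => p (eps i)) a, isSectionC hn hsub _ hQ, ?_⟩
  -- Each q_α with α divisible lies in H, hence q_α + H = H.
  have hpiece : piece (divRoots n)
      (fun α => (shiftSection (fun i => p (eps i)) a α +ᵥ (H : Set Y)) ∩ D.Λd) =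
      piece (divRoots n) (fun α => (H : Set Y) ∩ D.Λ α) := by
    ext ⟨α, y⟩
    refine and_congr_right fun hα => ?_
    have hα : α ∈ divRoots n := hα
    have hQH := hdiv α hα _ (hQ α (Or.inr hα))
    simp only [D.Λd_eq hα, Set.mem_inter_iff, mem_vadd_iff_sub_mem, SetLike.mem_coe]
    exact and_congr_left fun _ => ⟨fun h => by simpa using H.add_mem h hQH, fun h => H.sub_mem h hQH⟩
  rw [hpiece]
  refine D.eq_inter_union_piece hΨ hB _ (fun α hα y hy => ⟨hdiv α hα y hy, (hsub hy).2⟩)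
    (fun _ _ => Set.inter_subset_right) ?_ ?_ ?_
  · intro β hβ x hx α hα y hy
    have hα' := (hsub hy).1
    refine ⟨H.sub_mem hx.1 ?_, D.sub_mem α hα' β (mem_roots_of_div hβ) x hx.2 y (hsub hy).2⟩
    rcases hα with hα | hα
    · obtain ⟨m, hm⟩ := cartan_div_short hβ hα
      have := H.zsmul_mem (h2' y (D.subset_Λs hα (hsub hy).2)) (2 * m)
      rw [hm]
      convert this using 1
      rw [← Int.cast_smul_eq_zsmul ℝ, smul_smul]
      push_cast
      ring_nf
    · obtain ⟨m, hm⟩ := cartan_div_long hβ hα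
      have := H.zsmul_mem (h2' y (mem_Λs_of_long hα (hsub hy).2)) m
      rw [hm]
      convert this using 1
      rw [← Int.cast_smul_eq_zsmul ℝ, smul_smul, mul_comm]
  · intro β hβ x hx α hα y hy
    refine ⟨H.sub_mem hx.1 ?_, D.sub_mem α (mem_roots_of_div hα) β (mem_roots_of_div hβ) x hx.2
      y hy.2⟩
    obtain ⟨m, hm⟩ := cartan_div_div hβ hα
    have := H.zsmul_mem hy.1 (2 * m)
    rw [hm]
    rwa [← Int.cast_smul_eq_zsmul ℝ, Int.cast_mul, Int.cast_ofNat] at this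
  · intro β hβ x hx α hα y hy
    have hα' := mem_roots_of_div hα
    rcases hβ with hβ | hβ
    · have hβ' := reflect_short hα' hβ
      rw [mem_iff_of_short hsub hform hβ']
      exact D.subset_Λs hβ' (D.sub_mem α hα' β (mem_roots_of_short hβ) x (hsub hx).2 y hy.2)
    · rw [hl _ (reflect_long hα' hβ)]
      rw [hl _ hβ] at hx
      obtain ⟨m, hm⟩ := cartan_B_div (Or.inr hβ) hα
      have := H.add_mem hx (H.zsmul_mem (H.sub_mem (hPd α hα) hy.1) m)
      convert this using 1
      rw [hm, map_sub, map_smul, ← Int.cast_smul_eq_zsmul ℝ m]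
      module

section FormThree

variable {P : E n →ₗ[ℝ] Y} {S : Set Y} {H : AddSubgroup Y}

/-- If the fibres of `Ψ` over the roots of type `B_n` are `P_α + S` and `P_α + H`, then they are
compatible with the reflections in all `α ⊕ y`, `α` divisible, `y ∈ P_α + H`. -/
lemma reflect_mem_of_div (hs : ∀ α ∈ shortRoots n, ∀ y, (α, y) ∈ Ψ ↔ y - P α ∈ S)
    (hl : ∀ α ∈ longRoots n, ∀ y, (α, y) ∈ Ψ ↔ y - P α ∈ H)
    (hSH : ∀ t ∈ S, ∀ h ∈ H, t + h ∈ S) {β α : E n} (hβ : β ∈ shortRoots n ∪ longRoots n)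
    {x y : Y} (hx : (β, x) ∈ Ψ) (hα : α ∈ divRoots n) (hy : y - P α ∈ H) :
    (β - cartan β α • α, x - cartan β α • y) ∈ Ψ := by
  have hα' := mem_roots_of_div hα
  obtain ⟨m, hm⟩ := cartan_B_div hβ hα
  have e : x - cartan β α • y - P (β - cartan β α • α) = (x - P β) + -(m • (y - P α)) := by
    rw [hm, map_sub, map_smul, ← Int.cast_smul_eq_zsmul ℝ m]
    module
  have hm' : -(m • (y - P α)) ∈ H := H.neg_mem (H.zsmul_mem hy m)
  rcases hβ with hβ | hβ
  · rw [hs _ (reflect_short hα' hβ), e]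
    exact hSH _ ((hs _ hβ _).1 hx) _ hm'
  · rw [hl _ (reflect_long hα' hβ), e]
    exact H.add_mem ((hl _ hβ _).1 hx) hm'

/-- The translates of the divisible fibres by a linear section coincide. -/
lemma sub_add_mem_of_div (hΨ : IsRootSubsystem D.Φ Ψ) (Q : E n →ₗ[ℝ] Y)
    (hQ : ∀ α ∈ longRoots n ∪ divRoots n, (α, Q α) ∈ Ψ) {α β : E n} (hα : α ∈ divRoots n)
    (hβ : β ∈ divRoots n) {y : Y} (hy : (α, y) ∈ Ψ) : (β, y - Q α + Q β) ∈ Ψ := by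
  -- Reflecting α ⊕ y in γ ⊕ Q_γ preserves the difference between the second component and Q.
  have key : ∀ γ, (γ, Q γ) ∈ Ψ → β = α - cartan α γ • γ → (β, y - Q α + Q β) ∈ Ψ := by
    rintro γ hγ rfl
    have := hΨ.reflect_mem hγ hy
    convert this using 2
    rw [map_sub, map_smul]
    abel
  rcases div_connected hα hβ with rfl | h | ⟨γ, hγ, h⟩
  · simpa using hy
  · exact key α (hQ α (Or.inr hα)) h
  · exact key γ (hQ γ (Or.inl hγ)) h

end FormThree

end ExtensionDatum
end Forms
-- The third form: the common divisible fibre and its maximality.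
section FormThree

variable {n : ℕ} {Y : Type*} [AddCommGroup Y] [Module ℝ Y]

namespace ExtensionDatum

variable {D : ExtensionDatum n Y} {Ψ : Set (E n × Y)} {S : Set Y} {H : AddSubgroup Y}

/-- Maximality determines the divisible fibres, if they are contained in translates of a set `Z`
that is compatible with the reflections. -/
lemma eq_inter_union_piece_vadd (hΨ : IsMaximalRootSubsystem D.Φ Ψ) (hB : Ψ ∩ D.ΦB ≠ D.ΦB)
    (x : Fin n → Y) {a : Y} (ha : a ∈ H)
    (hs : ∀ α ∈ shortRoots n, ∀ y, (α, y) ∈ Ψ ↔ y - linSection x α ∈ S)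
    (hl : ∀ α ∈ longRoots n, ∀ y, (α, y) ∈ Ψ ↔ y - linSection x α ∈ H)
    (hSH : ∀ t ∈ S, ∀ h ∈ H, t + h ∈ S) (hS2 : ∀ t ∈ S, (2 : ℝ) • t ∈ H)
    {Z : Set Y} (hZH : Z ⊆ H) (hZ2 : ∀ z ∈ Z, ∀ h ∈ H, z + (2 : ℝ) • h ∈ Z)
    (hZΛ : ∀ α ∈ divRoots n, shiftSection x a α +ᵥ Z ⊆ D.Λd)
    (hΨZ : ∀ α ∈ divRoots n, ∀ y, (α, y) ∈ Ψ → y - shiftSection x a α ∈ Z) :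
    Ψ = (Ψ ∩ D.ΦB) ∪ piece (divRoots n) (fun α => shiftSection x a α +ᵥ Z) := by
  set P := linSection x with hP
  set Q := shiftSection x a with hQ
  refine D.eq_inter_union_piece hΨ hB _
    (fun α hα y hy => mem_vadd_iff_sub_mem.2 (hΨZ α hα y hy))
    (fun α hα => D.Λd_eq hα ▸ hZΛ α hα) ?_ ?_ ?_
  · intro β hβ u hu α hα y hy
    rw [mem_vadd_iff_sub_mem] at hu ⊢
    rcases hα with hα | hα
    · obtain ⟨m, hm⟩ := cartan_div_short hβ hα
      obtain ⟨k, hk⟩ := two_smul_sub_shiftSection_of_short x a hα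
      -- The sum is 2(y − Q_α), where Q is the shifted section. As the Cartan number is 4m, the
      -- displacement lies in 2H.
      have h1 := H.add_mem (hS2 _ ((hs α hα y).1 hy)) (hk ▸ H.zsmul_mem ha k)
      convert hZ2 _ hu _ (H.neg_mem (H.zsmul_mem h1 m)) using 1
      rw [hm, map_sub, map_smul, ← Int.cast_smul_eq_zsmul ℝ m]
      module
    · obtain ⟨m, hm⟩ := cartan_div_long hβ hα
      obtain ⟨k, hk⟩ := sub_shiftSection_of_long x a hα
      have h1 := H.add_mem ((hl α hα y).1 hy) (hk ▸ H.zsmul_mem ha k)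
      convert hZ2 _ hu _ (H.neg_mem (H.zsmul_mem h1 m)) using 1
      rw [hm, map_sub, map_smul, ← Int.cast_smul_eq_zsmul ℝ m]
      module
  · intro β hβ u hu α hα y hy
    rw [mem_vadd_iff_sub_mem] at hu hy ⊢
    obtain ⟨m, hm⟩ := cartan_div_div hβ hα
    convert hZ2 _ hu _ (H.neg_mem (H.zsmul_mem (hZH hy) m)) using 1
    rw [hm, map_sub, map_smul, ← Int.cast_smul_eq_zsmul ℝ m]
    module
  · intro β hβ u hu α hα y hy
    rw [mem_vadd_iff_sub_mem] at hy
    refine reflect_mem_of_div hs hl hSH hβ hu hα ?_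
    -- Replacing Q by P costs a multiple of a, which lies in H.
    obtain ⟨k, hk⟩ := sub_shiftSection_of_div x a hα
    have h1 := H.sub_mem (hZH hy) (hk ▸ H.zsmul_mem ha k)
    convert h1 using 1
    abel

lemma FormThree.mem_iff {p : E n → Y} (hΨ : Ψ ⊆ D.Φ) (h : D.FormThree p S H (Ψ ∩ D.ΦB)) :
    (∀ α ∈ shortRoots n, ∀ y, (α, y) ∈ Ψ ↔ y - linSection (fun i => p (eps i)) α ∈ S) ∧
    (∀ α ∈ longRoots n, ∀ y, (α, y) ∈ Ψ ↔ y - linSection (fun i => p (eps i)) α ∈ H) := by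
  obtain ⟨hp, -, -, -, hform⟩ := h
  refine ⟨fun α hα y => ?_, fun α hα y => ?_⟩
  · rw [mem_iff_of_short hΨ hform hα, mem_vadd_iff_sub_mem, hp.1.eq_linSection (Or.inl hα)]
  · rw [mem_iff_of_long hΨ hform hα, mem_vadd_iff_sub_mem, hp.1.eq_linSection (Or.inr hα),
      SetLike.mem_coe]

lemma formThree_eq_of_subset (hn : 2 ≤ n) (hΨ : IsMaximalRootSubsystem D.Φ Ψ)
    (hGr : D.Gr Ψ = roots n) (hB : Ψ ∩ D.ΦB ≠ D.ΦB) {p : E n → Y}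
    (h : D.FormThree p S H (Ψ ∩ D.ΦB)) (hd : D.Λd ⊆ H) :
    Ψ = (Ψ ∩ D.ΦB) ∪ piece (divRoots n) (fun _ => D.Λd) := by
  obtain ⟨hs, hl⟩ := h.mem_iff hΨ.1.2.1
  refine D.eq_inter_union_piece_Λd hΨ hB fun β hβ x hx α hα y hy => ?_
  refine reflect_mem_of_div hs hl h.2.2.2.1.prop.1.2 hβ hx hα ?_
  -- The full gradient supplies c ∈ P_α + H; since also c ∈ Λ_d ⊆ H, it follows that P_α ∈ H.
  obtain ⟨-, c, hcΛ, hc⟩ : α ∈ D.Gr Ψ := hGr ▸ mem_roots_of_div hα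
  have hcH := hΨ.1.sub_mem_of_div hn _ hl hα hc
  have := H.sub_mem (H.add_mem (hd (D.Λd_eq hα ▸ hy)) hcH) (hd (D.Λd_eq hα ▸ hcΛ))
  convert this using 1
  abel

lemma exists_formThree_eq (hn : 2 ≤ n) (hΨ : IsMaximalRootSubsystem D.Φ Ψ)
    (hGr : D.Gr Ψ = roots n) (hB : Ψ ∩ D.ΦB ≠ D.ΦB) {p : E n → Y}
    (h : D.FormThree p S H (Ψ ∩ D.ΦB)) :
    ∃ (p' : E n → Y) (Yd : Set Y) (a : Y),
      D.IsSectionC p' Ψ ∧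
      (∀ i j : Fin n, (i : ℕ) + 1 = j → p' (eps i - eps j) = p (eps i - eps j)) ∧
      (∀ i : Fin n, (i : ℕ) + 1 = n → a = (2 : ℤ) • p (eps i) - p' ((2 : ℝ) • eps i)) ∧
      Maximal (fun Z : Set Y =>
        IsUnionOfCosets ((fun h : Y => (2 : ℤ) • h) '' (H : Set Y)) (H : Set Y) Z ∧
        (∀ α ∈ divRoots n, p' α +ᵥ Z ⊆ D.Λd) ∧
        a +ᵥ S ⊆ S ∧ ((2 : ℤ) • a) +ᵥ Z ⊆ Z) Yd ∧
      Ψ = (Ψ ∩ D.ΦB) ∪ piece (divRoots n) (fun α => p' α +ᵥ Yd) := by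
  have hsub := hΨ.1.2.1
  obtain ⟨hs, hl⟩ := h.mem_iff hsub
  obtain ⟨hp, -, -, hS, -⟩ := h
  have hSH := hS.prop.1.2
  have two_eq : ∀ y : Y, (2 : ℤ) • y = (2 : ℝ) • y := fun y => by
    rw [← Int.cast_smul_eq_zsmul ℝ, Int.cast_ofNat]
  have hS2 : ∀ t ∈ S, (2 : ℝ) • t ∈ H := fun t ht => two_eq t ▸ hS.prop.2.2.1 t ht
  set x : Fin n → Y := fun i => p (eps i) with hx
  obtain ⟨a, ha, hQ⟩ := exists_shiftSection hn hΨ.1 hGr x hl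
  -- Any reference root serves: the divisible fibres, translated by the section, all coincide.
  obtain ⟨δ, hδ⟩ : (divRoots n).Nonempty := ⟨_, ⟨n - 1, by omega⟩, Or.inl rfl⟩
  let Yd : Set Y := {z | (δ, z + shiftSection x a δ) ∈ Ψ}
  have hfib : ∀ α ∈ divRoots n, ∀ y, (α, y) ∈ Ψ ↔ y - shiftSection x a α ∈ Yd := by
    refine fun α hα y => ⟨fun hy => sub_add_mem_of_div hΨ.1 _ hQ hα hδ hy, fun hy => ?_⟩
    simpa using sub_add_mem_of_div hΨ.1 _ hQ hδ hα hy
  have hYH : Yd ⊆ H := fun z hz => by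
    obtain ⟨k, hk⟩ := sub_shiftSection_of_div x a hδ
    have h1 := hΨ.1.sub_mem_of_div hn _ hl hδ hz
    have h2 := H.add_mem h1 (hk ▸ H.zsmul_mem ha k)
    rwa [sub_add_sub_cancel, add_sub_cancel_right] at h2
  have hY2 : ∀ z ∈ Yd, ∀ h ∈ H, z + (2 : ℝ) • h ∈ Yd := by
    intro z hz h hh
    obtain ⟨β, hβ, hc⟩ := exists_long_cartan_div hn hδ
    -- From (β, δ^∨) = 1 the inner product is 2, so (δ, β^∨) = 2. Reflecting in β ⊕ (Q_β − h) then
    -- moves the translated fibre by 2h.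
    have hc' : cartan δ β = 2 := by
      rw [cartan, inner_self_of_div hδ] at hc
      rw [cartan, inner_self_of_long hβ, real_inner_comm]
      linarith
    have hβΨ : (β, shiftSection x a β - h) ∈ Ψ := by
      rw [hl β hβ, sub_right_comm]
      exact H.sub_mem ((hl β hβ _).1 (hQ β (Or.inl hβ))) hh
    have key := hΨ.1.reflect_mem hβΨ hz
    rw [hfib _ (reflect_div (mem_roots_of_long hβ) hδ)] at key
    convert key using 1
    rw [hc', map_sub, map_smul]
    module
  have hYΛ : ∀ α ∈ divRoots n, shiftSection x a α +ᵥ Yd ⊆ D.Λd := by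
    intro α hα y hy
    rw [mem_vadd_iff_sub_mem, ← hfib α hα] at hy
    exact D.Λd_eq hα ▸ (hsub hy).2
  -- Used twice: with `Yd` it gives the formula for `Ψ`, and with a larger competitor Z it forces Z
  -- ⊆ `Yd`.
  have hmain : ∀ Z : Set Y, Yd ⊆ Z → Z ⊆ H → (∀ z ∈ Z, ∀ h ∈ H, z + (2 : ℝ) • h ∈ Z) →
      (∀ α ∈ divRoots n, shiftSection x a α +ᵥ Z ⊆ D.Λd) →
      Ψ = (Ψ ∩ D.ΦB) ∪ piece (divRoots n) (fun α => shiftSection x a α +ᵥ Z) :=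
    fun Z hYZ hZH hZ2 hZΛ => eq_inter_union_piece_vadd hΨ hB x ha hs hl hSH hS2 hZH hZ2 hZΛ
      fun α hα y hy => hYZ ((hfib α hα y).1 hy)
  refine ⟨shiftSection x a, Yd, a, isSectionC hn hsub _ hQ, fun i j hij => ?_, fun i _ => ?_,
    ⟨⟨⟨hYH, ?_⟩, hYΛ, ?_, ?_⟩, ?_⟩, hmain Yd subset_rfl hYH hY2 hYΛ⟩
  · have hij' : i ≠ j := by rintro rfl; omega
    rw [hp.1.eq_linSection (Or.inr ⟨i, j, hij', Or.inr (Or.inl rfl)⟩)]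
    simp [linSection_eps, shiftSection_eps, x]
  · rw [two_eq, map_smul, shiftSection_eps]
    module
  · rintro z hz - ⟨h, hh, rfl⟩
    simp only [two_eq]
    exact hY2 z hz h hh
  -- Both conditions on a follow from a ∈ H, by stability of S under H and of `Yd` under 2H.
  · rintro - ⟨t, ht, rfl⟩
    simp only [vadd_eq_add, add_comm a t]
    exact hSH t ht a ha
  · rintro - ⟨z, hz, rfl⟩
    simp only [vadd_eq_add, two_eq, add_comm _ z]
    exact hY2 z hz a ha
  · rintro Z ⟨⟨hZH, hZ2⟩, hZΛ, -, -⟩ hYZ z hz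
    have hΨZ := hmain Z hYZ hZH
      (fun z hz h hh => two_eq h ▸ hZ2 z hz _ ⟨h, hh, rfl⟩) hZΛ
    have : (δ, z + shiftSection x a δ) ∈
        (Ψ ∩ D.ΦB) ∪ piece (divRoots n) (fun α => shiftSection x a α +ᵥ Z) :=
      Or.inr ⟨hδ, mem_vadd_iff_sub_mem.2 (by simpa using hz)⟩
    rw [← hΨZ] at this
    exact this

end ExtensionDatum
end FormThree
end BCReflection

open BCReflection in
theorem proposition6p5 {n : ℕ} (hn : 2 ≤ n) {Y : Type*} [AddCommGroup Y] [Module ℝ Y]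
    [FiniteDimensional ℝ Y] (D : ExtensionDatum n Y)
    (hΛ : n = 2 → ∃ G : AddSubgroup Y, (G : Set Y) = D.Λl)
    (Ψ : Set (E n × Y)) (hΨ : IsMaximalRootSubsystem D.Φ Ψ)
    (hGr : D.Gr Ψ = roots n) (hB : Ψ ∩ D.ΦB ≠ D.ΦB) :
    (∀ (p : E n → Y) (S : Set Y), D.FormOne p S (Ψ ∩ D.ΦB) →
      Ψ = (Ψ ∩ D.ΦB) ∪ piece (divRoots n) (fun _ => D.Λd)) ∧
    (∀ (p : E n → Y) (H : AddSubgroup Y), D.FormTwo p H (Ψ ∩ D.ΦB) →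
      ∃ q : E n → Y, D.IsSectionC q Ψ ∧
        Ψ = (Ψ ∩ D.ΦB) ∪ piece (divRoots n) (fun α => (q α +ᵥ (H : Set Y)) ∩ D.Λd)) ∧
    (∀ (p : E n → Y) (S : Set Y) (H : AddSubgroup Y), D.FormThree p S H (Ψ ∩ D.ΦB) →
      (D.Λd ⊆ H → Ψ = (Ψ ∩ D.ΦB) ∪ piece (divRoots n) (fun _ => D.Λd)) ∧
      (¬ D.Λd ⊆ H →
        ∃ (p' : E n → Y) (Yd : Set Y) (a : Y),
          D.IsSectionC p' Ψ ∧
          (∀ i j : Fin n, (i : ℕ) + 1 = j → p' (eps i - eps j) = p (eps i - eps j)) ∧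
          (∀ i : Fin n, (i : ℕ) + 1 = n →
            a = (2 : ℤ) • p (eps i) - p' ((2 : ℝ) • eps i)) ∧
          Maximal (fun Z : Set Y =>
            IsUnionOfCosets ((fun h : Y => (2 : ℤ) • h) '' (H : Set Y)) (H : Set Y) Z ∧
            (∀ α ∈ divRoots n, p' α +ᵥ Z ⊆ D.Λd) ∧
            a +ᵥ S ⊆ S ∧ ((2 : ℤ) • a) +ᵥ Z ⊆ Z) Yd ∧
          Ψ = (Ψ ∩ D.ΦB) ∪ piece (divRoots n) (fun α => p' α +ᵥ Yd))) := by
  exact ⟨fun _ _ h => ExtensionDatum.formOne_eq hn hΨ hB h,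
    fun _ _ h => ExtensionDatum.formTwo_eq hn hΨ hGr hB h,
    fun _ _ _ h => ⟨ExtensionDatum.formThree_eq_of_subset hn hΨ hGr hB h,
      fun _ => ExtensionDatum.exists_formThree_eq hn hΨ hGr hB h⟩⟩
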